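/- Let $F\ge 0$ and $G\ge 1$ be integers, $\gamma,\zeta,\epsilon>0$, $\beta,\eta\ge 0$, $\mathbf C\in\mathbb R_+^{F\times G}$ and $\mathbf u\in\mathbb C^F$. All exponentials, logarithms, absolute values and positive parts $(\cdot)_+=\max(\cdot,0)$ are elementwise, $\odot$ is the elementwise product, $\|\mathbf\Psi\|_{1,\infty}=\max_g\sum_f|\Psi_{f,g}|$, and $\mathcal W$ is the elementwise Wright omega function: for real $x$, $\mathcal W(x)$ is the unique $w>0$ with $we^w=e^x$. Put $\mathbf K=\exp(-\mathbf C/\epsilon)$, $\mathbf W=\exp(\mathbf\Psi/\epsilon)$, $\mathbf v=\exp(\boldsymbol\lambda/\epsilon)$, and $$J(\boldsymbol\lambda,\mathbf\Psi)=\gamma\zeta\epsilon\,\langle \mathbf K\odot\mathbf W,\mathbf v\mathbf 1_G^T\rangle+\tfrac12\big\|\big(|\mathbf u|-\gamma\beta\mathbf 1_F-\gamma\zeta\boldsymbol\lambda\big)_+\big\|_2^2 .$$ The dual problem is to minimize $J$ over $\boldsymbol\lambda\in\mathbb R_+^F$ and $\mathbf\Psi\in\mathbb R^{F\times G}$ with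 $\|\mathbf\Psi\|_{1,\infty}\le\eta$. For $\mathbf\Psi\in\mathbb R^{F\times G}$ set $$\boldsymbol\xi(\mathbf\Psi)=\log\big((\mathbf K\odot\mathbf W)\mathbf 1_G\big)+\frac{|\mathbf u|-\gamma\beta\mathbf 1_F}{\gamma\zeta\epsilon}-\log(\gamma\zeta\epsilon\mathbf 1_F),\qquad \boldsymbol\ell(\mathbf\Psi)=\frac{1}{\gamma\zeta}|\mathbf u|-\frac{\beta}{\zeta}\mathbf 1_F-\epsilon\,\mathcal W\big(\boldsymbol\xi(\mathbf\Psi)\big).$$ Starting from any $\mathbf\Psi^{(0)}\in\mathbb R^{F\times G}$, consider for $k\ge 0$ the iterates $$\boldsymbol\lambda^{(k+1)}=\big(\boldsymbol\ell(\mathbf\Psi^{(k)})\big)_+,\qquad \mathbf\Psi^{(k+1)}=\arg\min_{\|\mathbf\Psi\|_{1,\infty}\le\eta}\Big\langle(\mathbf v^{(k+1)}\mathbf 1_G^T)\odot\mathbf K,\exp\big(\tfrac1\epsilon\mathbf\Psi\big)\Big\rangle,\qquad \mathbf v^{(k+1)}=\exp\big(\tfrac1\epsilon\boldsymbol\lambda^{(k+1)}\big),$$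 where the minimizer exists and is unique. Then $(\boldsymbol\lambda^{(k)},\mathbf\Psi^{(k)})$ converges linearly to a solution $(\boldsymbol\lambda^\star,\mathbf\Psi^\star)$ of the dual problem, i.e. there are $A$ and $q\in(0,1)$ with $\big(\|\boldsymbol\lambda^{(k)}-\boldsymbol\lambda^\star\|_2^2+\|\mathbf\Psi^{(k)}-\mathbf\Psi^\star\|_F^2\big)^{1/2}\le A q^k$ for all $k\ge 1$. If the update $\boldsymbol\lambda^{(k+1)}=\boldsymbol\ell(\mathbf\Psi^{(k)})$ without positive part is used instead, the iterates converge linearly, in the same sense, to a minimizer of $J$ over $\boldsymbol\lambda\in\mathbb R^F$, $\|\mathbf\Psi\|_{1,\infty}\le\eta$; if its $\boldsymbol\lambda$-part is nonnegative, it is a solution of the dual problem. -/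

import Mathlib

namespace DetDual

/-- Existence and uniqueness behind the definition of the Wright omega function on `ℝ`. -/
theorem existsUnique_omega (x : ℝ) : ∃! w : ℝ, 0 < w ∧ w * Real.exp w = Real.exp x := by
  have hmono : ∀ a b : ℝ, 0 < a → a < b → a * Real.exp a < b * Real.exp b := by
    intro a b ha hab
    have h1 : Real.exp a < Real.exp b := Real.exp_lt_exp.mpr hab
    have h2 := Real.exp_pos a
    nlinarith
  have hcont : ContinuousOn (fun w : ℝ => w * Real.exp w) (Set.Icc 0 (Real.exp x)) := by
    fun_prop
  have hx := Real.exp_pos x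
  have hmem : Real.exp x ∈ Set.Icc ((0 : ℝ) * Real.exp 0)
      (Real.exp x * Real.exp (Real.exp x)) := by
    have h1 : (1 : ℝ) ≤ Real.exp (Real.exp x) := Real.one_le_exp hx.le
    constructor <;> nlinarith
  obtain ⟨w, hw, hwe⟩ := intermediate_value_Icc hx.le hcont hmem
  have hwe' : w * Real.exp w = Real.exp x := hwe
  have hw0 : 0 < w := by
    rcases hw.1.lt_or_eq with h | h
    · exact h
    · rw [← h, zero_mul] at hwe'
      exact absurd hwe' hx.ne
  refine ⟨w, ⟨hw0, hwe'⟩, ?_⟩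
  rintro y ⟨hy0, hye⟩
  rcases lt_trichotomy y w with h | h | h
  · have := hmono y w hy0 h
    linarith
  · exact h
  · have := hmono w y hw0 h
    linarith

/-- The Wright omega function at a real argument, `ω(x) = W₀(eˣ)` with `W₀` the principal branch
of the Lambert function: the unique `w > 0` with `w eʷ = eˣ`. -/
noncomputable def wrightOmega (x : ℝ) : ℝ := (existsUnique_omega x).choose

theorem wrightOmega_pos (x : ℝ) : 0 < wrightOmega x :=
  (existsUnique_omega x).choose_spec.1.1

theorem wrightOmega_mul_exp (x : ℝ) :
    wrightOmega x * Real.exp (wrightOmega x) = Real.exp x :=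
  (existsUnique_omega x).choose_spec.1.2

/-- The defining relation in its logarithmic form, `ω(x) + log ω(x) = x`. -/
theorem wrightOmega_add_log (x : ℝ) : wrightOmega x + Real.log (wrightOmega x) = x := by
  have h := congrArg Real.log (wrightOmega_mul_exp x)
  rw [Real.log_mul (wrightOmega_pos x).ne' (Real.exp_pos _).ne', Real.log_exp, Real.log_exp] at h
  linarith

variable {F G : ℕ}

/-- `K = exp(-C/ε)`, elementwise. -/
noncomputable def kernelK (ε : ℝ) (C : Matrix (Fin F) (Fin G) ℝ) : Matrix (Fin F) (Fin G) ℝ :=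
  fun f g => Real.exp (-(C f g) / ε)

/-- `W = exp(Ψ/ε)`, elementwise. -/
noncomputable def kernelW (ε : ℝ) (Psi : Matrix (Fin F) (Fin G) ℝ) : Matrix (Fin F) (Fin G) ℝ :=
  fun f g => Real.exp (Psi f g / ε)

/-- `v = exp(lam/ε)`, elementwise. -/
noncomputable def scalingV (ε : ℝ) (lam : Fin F → ℝ) : Fin F → ℝ :=
  fun f => Real.exp (lam f / ε)

/-- The mixed norm `‖Ψ‖_{1,∞} = max_g ∑_f |Ψ_{f,g}|`. -/
noncomputable def normOneInf (Psi : Matrix (Fin F) (Fin G) ℝ) : ℝ :=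
  ⨆ g : Fin G, ∑ f : Fin F, |Psi f g|

/-- The dual objective
`γζε ⟨K ⊙ W, v 1ᵀ⟩ + ½ ‖(|u| - γβ 1 - γζ lam)₊‖₂²`. -/
noncomputable def dualObjective (γ ζ ε β : ℝ) (C : Matrix (Fin F) (Fin G) ℝ) (u : Fin F → ℂ)
    (lam : Fin F → ℝ) (Psi : Matrix (Fin F) (Fin G) ℝ) : ℝ :=
  γ * ζ * ε * (∑ f : Fin F, ∑ g : Fin G, kernelK ε C f g * kernelW ε Psi f g * scalingV ε lam f)
    + 1 / 2 * ∑ f : Fin F, (max (‖u f‖ - γ * β - γ * ζ * lam f) 0) ^ 2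

/-- `(lam, Psi)` minimizes the dual objective over `lam ∈ Λ`, `‖Ψ‖_{1,∞} ≤ η`. -/
def IsDualMinimizer (Λ : Set (Fin F → ℝ)) (γ ζ ε β η : ℝ) (C : Matrix (Fin F) (Fin G) ℝ)
    (u : Fin F → ℂ) (lam : Fin F → ℝ) (Psi : Matrix (Fin F) (Fin G) ℝ) : Prop :=
  lam ∈ Λ ∧ normOneInf Psi ≤ η ∧
    ∀ (lam' : Fin F → ℝ) (Psi' : Matrix (Fin F) (Fin G) ℝ), lam' ∈ Λ → normOneInf Psi' ≤ η →
      dualObjective γ ζ ε β C u lam Psi ≤ dualObjective γ ζ ε β C u lam' Psi'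

/-- A solution of the dual problem, in which `lam` ranges over `ℝ₊^F`. -/
def IsDualSolution (γ ζ ε β η : ℝ) (C : Matrix (Fin F) (Fin G) ℝ) (u : Fin F → ℂ)
    (lam : Fin F → ℝ) (Psi : Matrix (Fin F) (Fin G) ℝ) : Prop :=
  IsDualMinimizer {l | ∀ f, 0 ≤ l f} γ ζ ε β η C u lam Psi

/-- `ξ = log((K ⊙ W) 1_G) + (|u| - γβ 1_F)/(γζε) - log(γζε 1_F)`. -/
noncomputable def xi (γ ζ ε β : ℝ) (C : Matrix (Fin F) (Fin G) ℝ) (u : Fin F → ℂ)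
    (Psi : Matrix (Fin F) (Fin G) ℝ) : Fin F → ℝ :=
  fun f => Real.log (∑ g : Fin G, kernelK ε C f g * kernelW ε Psi f g)
    + (‖u f‖ - γ * β) / (γ * ζ * ε) - Real.log (γ * ζ * ε)

/-- The closed-form expression `|u|/(γζ) - (β/ζ) 1_F - ε ω(ξ)` for the `lam`-block. -/
noncomputable def lamFormula (γ ζ ε β : ℝ) (C : Matrix (Fin F) (Fin G) ℝ) (u : Fin F → ℂ)
    (Psi : Matrix (Fin F) (Fin G) ℝ) : Fin F → ℝ :=
  fun f => 1 / (γ * ζ) * ‖u f‖ - β / ζ - ε * wrightOmega (xi γ ζ ε β C u Psi f)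

/-- The objective `⟨(v 1_Gᵀ) ⊙ K, exp(Ψ/ε)⟩` of the `Psi`-block, `v = exp(lam/ε)`. -/
noncomputable def psiObjective (ε : ℝ) (C : Matrix (Fin F) (Fin G) ℝ) (lam : Fin F → ℝ)
    (Psi : Matrix (Fin F) (Fin G) ℝ) : ℝ :=
  ∑ f : Fin F, ∑ g : Fin G, scalingV ε lam f * kernelK ε C f g * Real.exp (Psi f g / ε)

/-- `Psi` is a minimizer of the `Psi`-block objective over `‖Ψ‖_{1,∞} ≤ η`. -/
def IsPsiArgmin (ε η : ℝ) (C : Matrix (Fin F) (Fin G) ℝ) (lam : Fin F → ℝ)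
    (Psi : Matrix (Fin F) (Fin G) ℝ) : Prop :=
  normOneInf Psi ≤ η ∧
    ∀ Psi' : Matrix (Fin F) (Fin G) ℝ, normOneInf Psi' ≤ η →
      psiObjective ε C lam Psi ≤ psiObjective ε C lam Psi'

/-- Iterates of the scheme: `lam^(k+1)` is given by `step` applied to `Psi^(k)`, and `Psi^(k+1)` is
the minimizer of the `Psi`-block for `lam^(k+1)`. The start `Psi^(0)` is arbitrary (`lam^(0)` is
never used). -/
def IsIteration (step : Matrix (Fin F) (Fin G) ℝ → Fin F → ℝ) (ε η : ℝ)
    (C : Matrix (Fin F) (Fin G) ℝ) (lam : ℕ → Fin F → ℝ)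
    (Psi : ℕ → Matrix (Fin F) (Fin G) ℝ) : Prop :=
  ∀ k : ℕ, lam (k + 1) = step (Psi k) ∧ IsPsiArgmin ε η C (lam (k + 1)) (Psi (k + 1))

/-- (Root-)linear convergence of `(lam^(k), Psi^(k))` to `(lamS, PsiS)`: the Euclidean error is
bounded by `A q^k` with some `q < 1`. -/
def ConvergesLinearly (lam : ℕ → Fin F → ℝ) (Psi : ℕ → Matrix (Fin F) (Fin G) ℝ)
    (lamS : Fin F → ℝ) (PsiS : Matrix (Fin F) (Fin G) ℝ) : Prop :=
  ∃ A q : ℝ, 0 < q ∧ q < 1 ∧ ∀ k : ℕ,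
    Real.sqrt (∑ f : Fin F, (lam k f - lamS f) ^ 2
      + ∑ f : Fin F, ∑ g : Fin G, (Psi k f g - PsiS f g) ^ 2) ≤ A * q ^ k

end DetDual

namespace DetDual

/-! Both `lam`-updates minimize the dual objective exactly in `lam` for fixed `Psi`, over the
orthant or over the whole space, so each scheme is two-block alternating minimization of a convex
function. From the second step on, the iterates stay in a compact box times the norm ball. There
`exp` is strongly convex with Lipschitz derivative, and the positive-part term is exactly quadratic
because `lam` stays below the threshold `(|u| - γβ)/(γζ)`, or is frozen at 0. The exponentials see
only `lam f + Psi f g`; the quadratic term adds curvature in `lam` alone, and together they control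
both blocks.

The gap to the optimum contracts (`exists_gap_contraction`): optimality of `Psi` removes its linear
term from the strong convexity bound, and a short `lam`-step towards the solution then gains a fixed
fraction of the gap. The exact `lam`-step does at least as well, and the `Psi`-step only decreases
the objective. Quadratic growth (`exists_quadratic_growth`) turns decay of the gap into decay of the
error. -/

/-! ### Scalar convexity estimates -/

theorem exp_sub_one_sub_id_ge {D d : ℝ} (hD : 2 ≤ D) (hd : |d| ≤ D) :
    d ^ 2 / (2 * D) ≤ Real.exp d - 1 - d := by
  have hd' := abs_le.mp hd
  rw [div_le_iff₀ (by linarith)]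
  rcases le_or_gt (-2) d with h | h
  · have h1 := Real.add_one_le_exp (d / 2)
    have h2 : Real.exp d = Real.exp (d / 2) ^ 2 := by
      rw [← Real.exp_nat_mul]; congr 1; push_cast; ring
    have h3 : d ^ 2 / 4 ≤ Real.exp d - 1 - d := by rw [h2]; nlinarith
    nlinarith [sq_nonneg d]
  · have h1 := Real.exp_pos d
    have h2 : -d / 2 ≤ Real.exp d - 1 - d := by linarith
    nlinarith

/-- For `|d| ≤ 1` this is Taylor's estimate; beyond that `d² ≥ 1` absorbs the crude bound `exp D +
D`. -/
theorem exp_sub_one_sub_id_le {D d : ℝ} (hd : |d| ≤ D) :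
    Real.exp d - 1 - d ≤ (Real.exp D + D + 1) * d ^ 2 := by
  have hD : 0 ≤ D := (abs_nonneg d).trans hd
  have hd' := abs_le.mp hd
  have hE := Real.exp_pos D
  rcases le_or_gt |d| 1 with h | h
  · have h1 := (abs_le.mp (Real.abs_exp_sub_one_sub_id_le h)).2
    nlinarith [sq_nonneg d]
  · have h1 : Real.exp d ≤ Real.exp D := Real.exp_le_exp.mpr hd'.2
    have h2 : 1 ≤ d ^ 2 := by rw [← sq_abs]; nlinarith
    nlinarith

/-- On a bounded interval the exponential is strongly convex and has a Lipschitz derivative. -/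
theorem exists_exp_quadratic_bounds (R : ℝ) : ∃ m M : ℝ, 0 < m ∧ 0 < M ∧
    ∀ x y : ℝ, |x| ≤ R → |y| ≤ R →
      Real.exp x + Real.exp x * (y - x) + m * (y - x) ^ 2 ≤ Real.exp y ∧
      Real.exp y ≤ Real.exp x + Real.exp x * (y - x) + M * (y - x) ^ 2 := by
  -- `D` dominates every difference `y - x` and is at least 2, as the lower bound needs.
  obtain ⟨D, hD⟩ : ∃ D, D = 2 * |R| + 2 := ⟨_, rfl⟩
  have hD2 : 2 ≤ D := by have := abs_nonneg R; linarith
  refine ⟨Real.exp (-R) / (2 * D), Real.exp R * (Real.exp D + D + 1), by positivity,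
    by positivity, fun x y hx hy => ?_⟩
  have hd : |y - x| ≤ D := by
    have := abs_sub y x
    have := le_abs_self R
    linarith
  have h1 := exp_sub_one_sub_id_ge hD2 hd
  have h2 := exp_sub_one_sub_id_le hd
  have hxy : Real.exp y = Real.exp x * Real.exp (y - x) := by
    rw [← Real.exp_add]; congr 1; ring
  have hx' := abs_le.mp hx
  have h3 : Real.exp (-R) ≤ Real.exp x := Real.exp_le_exp.mpr hx'.1
  have h4 : Real.exp x ≤ Real.exp R := Real.exp_le_exp.mpr hx'.2
  have h5 := Real.exp_pos x
  constructor
  · have h6 : Real.exp (-R) / (2 * D) * (y - x) ^ 2 ≤ Real.exp x * ((y - x) ^ 2 / (2 * D)) := by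
      rw [div_mul_eq_mul_div, ← mul_div_assoc]
      gcongr
    have h7 := mul_le_mul_of_nonneg_left h1 h5.le
    rw [hxy]
    linarith
  · have h6 : Real.exp x * ((Real.exp D + D + 1) * (y - x) ^ 2)
        ≤ Real.exp R * ((Real.exp D + D + 1) * (y - x) ^ 2) := by gcongr
    have h7 := mul_le_mul_of_nonneg_left h2 h5.le
    rw [hxy]
    linarith

theorem nonneg_of_forall_quadratic_nonneg {g c : ℝ}
    (h : ∀ t : ℝ, 0 < t → t ≤ 1 → 0 ≤ t * g + t ^ 2 * c) : 0 ≤ g := by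
  by_contra! hg
  -- For `t = -g / (|c| + 1 - g)` one has `g + t|c| = -t(1 - g) < 0`, a contradiction.
  have hc : 0 < |c| + 1 - g := by have := abs_nonneg c; linarith
  have ht : 0 < -g / (|c| + 1 - g) := div_pos (by linarith) hc
  have h1 := h (-g / (|c| + 1 - g)) ht (by rw [div_le_one hc]; linarith [abs_nonneg c])
  have h2 : 0 ≤ -g / (|c| + 1 - g) * (g + -g / (|c| + 1 - g) * c) := by linarith
  have h3 := nonneg_of_mul_nonneg_right h2 ht
  have h4 : -g / (|c| + 1 - g) * c ≤ -g / (|c| + 1 - g) * |c| := by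
    gcongr; exact le_abs_self c
  have h5 : -g / (|c| + 1 - g) * (|c| + 1 - g) = -g := div_mul_cancel₀ _ hc.ne'
  nlinarith

/-- Tangent inequality for the convex function `q ↦ (q₊)² / 2`. -/
theorem half_sq_posPart_tangent (p q : ℝ) :
    1 / 2 * max p 0 ^ 2 + max p 0 * (q - p) ≤ 1 / 2 * max q 0 ^ 2 := by
  rcases max_cases p 0 with ⟨h1, h1'⟩ | ⟨h1, h1'⟩ <;>
  rcases max_cases q 0 with ⟨h2, h2'⟩ | ⟨h2, h2'⟩ <;> rw [h1, h2] <;>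
  nlinarith [sq_nonneg (q - p)]

/-! ### The mixed-norm ball -/

variable {F G : ℕ}

theorem normOneInf_le_iff (hG : 0 < G) {η : ℝ} {P : Matrix (Fin F) (Fin G) ℝ} :
    normOneInf P ≤ η ↔ ∀ g, ∑ f, |P f g| ≤ η := by
  have : Nonempty (Fin G) := ⟨⟨0, hG⟩⟩
  exact ciSup_le_iff (Set.finite_range _).bddAbove

theorem abs_le_of_normOneInf_le (hG : 0 < G) {η : ℝ} {P : Matrix (Fin F) (Fin G) ℝ}
    (h : normOneInf P ≤ η) (f : Fin F) (g : Fin G) : |P f g| ≤ η :=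
  (Finset.single_le_sum (f := fun f => |P f g|) (fun _ _ => abs_nonneg _)
    (Finset.mem_univ f)).trans ((normOneInf_le_iff hG).mp h g)

theorem normOneInf_zero_le (hG : 0 < G) {η : ℝ} (hη : 0 ≤ η) :
    normOneInf (0 : Matrix (Fin F) (Fin G) ℝ) ≤ η := by
  rw [normOneInf_le_iff hG]; intro g; simpa using hη

theorem normOneInf_segment_le (hG : 0 < G) {η t : ℝ} (ht : 0 ≤ t) (ht1 : t ≤ 1)
    {P Q : Matrix (Fin F) (Fin G) ℝ} (hP : normOneInf P ≤ η) (hQ : normOneInf Q ≤ η) :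
    normOneInf (P + t • (Q - P)) ≤ η := by
  rw [normOneInf_le_iff hG] at hP hQ ⊢
  intro g
  calc ∑ f, |(P + t • (Q - P)) f g|
      ≤ ∑ f, ((1 - t) * |P f g| + t * |Q f g|) := by
        refine Finset.sum_le_sum fun f _ => ?_
        have : (P + t • (Q - P)) f g = (1 - t) * P f g + t * Q f g := by
          simp only [Matrix.add_apply, Matrix.smul_apply, Matrix.sub_apply, smul_eq_mul]; ring
        rw [this]
        refine (abs_add_le _ _).trans ?_
        rw [abs_mul, abs_mul, abs_of_nonneg ht, abs_of_nonneg (by linarith : 0 ≤ 1 - t)]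
    _ = (1 - t) * ∑ f, |P f g| + t * ∑ f, |Q f g| := by
        rw [Finset.sum_add_distrib, Finset.mul_sum, Finset.mul_sum]
    _ ≤ η := by nlinarith [hP g, hQ g]

theorem isCompact_normOneInf_le (hG : 0 < G) (η : ℝ) :
    IsCompact {P : Fin F → Fin G → ℝ | normOneInf (P : Matrix (Fin F) (Fin G) ℝ) ≤ η} := by
  have hset : {P : Fin F → Fin G → ℝ | normOneInf (P : Matrix (Fin F) (Fin G) ℝ) ≤ η}
      = ⋂ g, {P : Fin F → Fin G → ℝ | ∑ f, |P f g| ≤ η} := by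
    ext P
    simp only [Set.mem_ofPred_eq, Set.mem_iInter]
    exact normOneInf_le_iff hG
  refine IsCompact.of_isClosed_subset (isCompact_Icc (a := fun _ _ => -η) (b := fun _ _ => η)) ?_ ?_
  · rw [hset]
    refine isClosed_iInter fun g => isClosed_le ?_ continuous_const
    fun_prop
  · intro P hP
    have := fun f g => abs_le.mp (abs_le_of_normOneInf_le hG (P := P) hP f g)
    exact ⟨fun f g => (this f g).1, fun f g => (this f g).2⟩

/-! ### The dual objective and the `Psi`-block -/

/-- The exponent `(lam + Psi - C) / ε` of the entries of the scaled kernel. -/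
noncomputable def dualExponent (ε : ℝ) (C : Matrix (Fin F) (Fin G) ℝ) (lam : Fin F → ℝ)
    (Psi : Matrix (Fin F) (Fin G) ℝ) (f : Fin F) (g : Fin G) : ℝ :=
  (lam f + Psi f g - C f g) / ε

theorem dualObjective_eq (γ ζ ε β : ℝ) (C : Matrix (Fin F) (Fin G) ℝ) (u : Fin F → ℂ)
    (lam : Fin F → ℝ) (Psi : Matrix (Fin F) (Fin G) ℝ) :
    dualObjective γ ζ ε β C u lam Psi =
      γ * ζ * ε * (∑ f, ∑ g, Real.exp (dualExponent ε C lam Psi f g))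
        + ∑ f, 1 / 2 * (max (‖u f‖ - γ * β - γ * ζ * lam f) 0) ^ 2 := by
  unfold dualObjective kernelK kernelW scalingV dualExponent
  rw [Finset.mul_sum Finset.univ (fun f => (max (‖u f‖ - γ * β - γ * ζ * lam f) 0) ^ 2)]
  congr 2
  refine Finset.sum_congr rfl fun f _ => Finset.sum_congr rfl fun g _ => ?_
  rw [← Real.exp_add, ← Real.exp_add]
  congr 1
  ring

theorem psiObjective_eq (ε : ℝ) (C : Matrix (Fin F) (Fin G) ℝ)
    (lam : Fin F → ℝ) (Psi : Matrix (Fin F) (Fin G) ℝ) :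
    psiObjective ε C lam Psi = ∑ f, ∑ g, Real.exp (dualExponent ε C lam Psi f g) := by
  unfold psiObjective kernelK scalingV dualExponent
  refine Finset.sum_congr rfl fun f _ => Finset.sum_congr rfl fun g _ => ?_
  rw [← Real.exp_add, ← Real.exp_add]
  congr 1
  ring

theorem continuous_dualObjective (γ ζ ε β : ℝ) (C : Matrix (Fin F) (Fin G) ℝ) (u : Fin F → ℂ) :
    Continuous fun z : (Fin F → ℝ) × (Fin F → Fin G → ℝ) =>
      dualObjective γ ζ ε β C u z.1 z.2 := by
  unfold dualObjective kernelK kernelW scalingV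
  fun_prop

theorem continuous_psiObjective (ε : ℝ) (C : Matrix (Fin F) (Fin G) ℝ) (lam : Fin F → ℝ) :
    Continuous fun P : Fin F → Fin G → ℝ => psiObjective ε C lam P := by
  unfold psiObjective
  fun_prop

/-- Compactness of the ball gives existence. Strict convexity of `exp` gives uniqueness: the
midpoint of two distinct minimizers would do strictly better. -/
theorem existsUnique_isPsiArgmin (hG : 0 < G) {ε η : ℝ} (hε : 0 < ε) (hη : 0 ≤ η)
    (C : Matrix (Fin F) (Fin G) ℝ) (lam : Fin F → ℝ) :
    ∃! Psi : Matrix (Fin F) (Fin G) ℝ, IsPsiArgmin ε η C lam Psi := by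
  obtain ⟨P, hP⟩ : ∃ P : Matrix (Fin F) (Fin G) ℝ, IsPsiArgmin ε η C lam P := by
    obtain ⟨P, hP, hmin⟩ := (isCompact_normOneInf_le (F := F) hG η).exists_isMinOn
      ⟨0, normOneInf_zero_le hG hη⟩ (continuous_psiObjective ε C lam).continuousOn
    exact ⟨P, hP, fun P' hP' => hmin hP'⟩
  refine ⟨P, hP, fun Q hQ => ?_⟩
  by_contra hne
  obtain ⟨f₀, g₀, hfg⟩ : ∃ f g, Q f g ≠ P f g := by
    by_contra! h
    exact hne (Matrix.ext h)
  have hmid := normOneInf_segment_le hG (t := 1 / 2) (by norm_num) (by norm_num) hP.1 hQ.1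
  have h1 := hQ.2 _ hmid
  have h2 := hP.2 _ hmid
  have key : ∀ x y : ℝ, x ≠ y → 2 * Real.exp (1 / 2 * x + 1 / 2 * y) < Real.exp x + Real.exp y := by
    intro x y hxy
    have := strictConvexOn_exp.2 (Set.mem_univ x) (Set.mem_univ y) hxy
      (by norm_num : (0 : ℝ) < 1 / 2) (by norm_num : (0 : ℝ) < 1 / 2) (by norm_num)
    simp only [smul_eq_mul] at this
    linarith
  have hmideq : ∀ f g, dualExponent ε C lam (P + (1 / 2 : ℝ) • (Q - P)) f g
      = 1 / 2 * dualExponent ε C lam P f g + 1 / 2 * dualExponent ε C lam Q f g := by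
    intro f g
    simp only [dualExponent, Matrix.add_apply, Matrix.smul_apply, Matrix.sub_apply, smul_eq_mul]
    ring
  have hle : ∀ f g, 2 * Real.exp (dualExponent ε C lam
      (P + (1 / 2 : ℝ) • (Q - P)) f g)
      ≤ Real.exp (dualExponent ε C lam P f g) + Real.exp (dualExponent ε C lam Q f g) := by
    intro f g
    rw [hmideq]
    by_cases hxy : dualExponent ε C lam P f g = dualExponent ε C lam Q f g
    · rw [hxy, ← add_mul]; norm_num; linarith
    · exact (key _ _ hxy).le
  have hlt : ∑ f, ∑ g, 2 * Real.exp (dualExponent ε C lam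
      (P + (1 / 2 : ℝ) • (Q - P)) f g)
      < ∑ f, ∑ g, (Real.exp (dualExponent ε C lam P f g)
        + Real.exp (dualExponent ε C lam Q f g)) := by
    refine Finset.sum_lt_sum (fun f _ => Finset.sum_le_sum fun g _ => hle f g)
      ⟨f₀, Finset.mem_univ _, Finset.sum_lt_sum (fun g _ => hle f₀ g) ⟨g₀, Finset.mem_univ _, ?_⟩⟩
    rw [hmideq]
    refine key _ _ fun h => hfg ?_
    unfold dualExponent at h
    rw [div_left_inj' hε.ne'] at h
    linarith
  simp only [psiObjective_eq] at h1 h2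
  simp only [← Finset.mul_sum, Finset.sum_add_distrib] at hlt
  linarith

theorem dualObjective_eq_psiObjective (γ ζ ε β : ℝ) (C : Matrix (Fin F) (Fin G) ℝ) (u : Fin F → ℂ)
    (lam : Fin F → ℝ) (Psi : Matrix (Fin F) (Fin G) ℝ) :
    dualObjective γ ζ ε β C u lam Psi = γ * ζ * ε * psiObjective ε C lam Psi
        + ∑ f, 1 / 2 * (max (‖u f‖ - γ * β - γ * ζ * lam f) 0) ^ 2 := by
  rw [dualObjective_eq, psiObjective_eq]

theorem dualObjective_eq_sum (γ ζ ε β : ℝ) (C : Matrix (Fin F) (Fin G) ℝ) (u : Fin F → ℂ)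
    (lam : Fin F → ℝ) (Psi : Matrix (Fin F) (Fin G) ℝ) :
    dualObjective γ ζ ε β C u lam Psi =
      ∑ f, (γ * ζ * ε * (∑ g, Real.exp (dualExponent ε C lam Psi f g))
        + 1 / 2 * (max (‖u f‖ - γ * β - γ * ζ * lam f) 0) ^ 2) := by
  rw [dualObjective_eq, Finset.mul_sum, Finset.sum_add_distrib]

/-! ### First- and second-order bounds for the objective -/

/-- The derivative of the dual objective with respect to `lam f`. -/
noncomputable def gradLam (γ ζ ε β : ℝ) (C : Matrix (Fin F) (Fin G) ℝ) (u : Fin F → ℂ)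
    (lam : Fin F → ℝ) (Psi : Matrix (Fin F) (Fin G) ℝ) (f : Fin F) : ℝ :=
  γ * ζ * (∑ g, Real.exp (dualExponent ε C lam Psi f g))
    - γ * ζ * max (‖u f‖ - γ * β - γ * ζ * lam f) 0

/-- Strong convexity jointly in both blocks. The exponent moves by `((l' f - l f) + (P' f g - P f
g)) / ε`, so the exponential part yields only the coupled square; `hφ` supplies the pure `lam`
square. -/
theorem dualObjective_ge {γ ζ ε β : ℝ} (hγ : 0 < γ) (hζ : 0 < ζ) (hε : 0 < ε)
    (C : Matrix (Fin F) (Fin G) ℝ) (u : Fin F → ℂ) {R m : ℝ}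
    (hm : ∀ x y : ℝ, |x| ≤ R → |y| ≤ R →
      Real.exp x + Real.exp x * (y - x) + m * (y - x) ^ 2 ≤ Real.exp y)
    {l l' : Fin F → ℝ} {P P' : Matrix (Fin F) (Fin G) ℝ}
    (hX : ∀ f g, |dualExponent ε C l P f g| ≤ R) (hX' : ∀ f g, |dualExponent ε C l' P' f g| ≤ R)
    (hφ : ∀ f, 1 / 2 * (max (‖u f‖ - γ * β - γ * ζ * l' f) 0) ^ 2
      = 1 / 2 * (max (‖u f‖ - γ * β - γ * ζ * l f) 0) ^ 2
        - γ * ζ * max (‖u f‖ - γ * β - γ * ζ * l f) 0 * (l' f - l f)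
        + (γ * ζ) ^ 2 / 2 * (l' f - l f) ^ 2) :
    dualObjective γ ζ ε β C u l P + ∑ f, gradLam γ ζ ε β C u l P f * (l' f - l f)
      + ∑ f, ∑ g, γ * ζ * Real.exp (dualExponent ε C l P f g) * (P' f g - P f g)
      + γ * ζ * m / ε * ∑ f, ∑ g, ((l' f - l f) + (P' f g - P f g)) ^ 2
      + (γ * ζ) ^ 2 / 2 * ∑ f, (l' f - l f) ^ 2 ≤ dualObjective γ ζ ε β C u l' P' := by
  rw [dualObjective_eq_sum, dualObjective_eq_sum, Finset.mul_sum, Finset.mul_sum,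
    ← Finset.sum_add_distrib, ← Finset.sum_add_distrib, ← Finset.sum_add_distrib,
    ← Finset.sum_add_distrib]
  refine Finset.sum_le_sum fun f _ => ?_
  have hg : ∀ g, γ * ζ * ε * Real.exp (dualExponent ε C l P f g)
      + (γ * ζ * Real.exp (dualExponent ε C l P f g) * (l' f - l f)
      + γ * ζ * Real.exp (dualExponent ε C l P f g) * (P' f g - P f g))
      + γ * ζ * m / ε * ((l' f - l f) + (P' f g - P f g)) ^ 2
      ≤ γ * ζ * ε * Real.exp (dualExponent ε C l' P' f g) := by
    intro g
    have h1 := mul_le_mul_of_nonneg_left (hm _ _ (hX f g) (hX' f g))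
      (by positivity : 0 ≤ γ * ζ * ε)
    have h2 : dualExponent ε C l' P' f g - dualExponent ε C l P f g
        = ((l' f - l f) + (P' f g - P f g)) / ε := by
      unfold dualExponent; ring
    rw [h2] at h1
    refine le_trans (le_of_eq ?_) h1
    field_simp
  have hs := Finset.sum_le_sum fun g (_ : g ∈ Finset.univ) => hg g
  simp only [Finset.sum_add_distrib, ← Finset.mul_sum, ← Finset.sum_mul] at hs
  have := hφ f
  simp only [gradLam]
  linarith

/-- Smoothness in `lam` alone. All `G` entries of a row undergo the same shift, hence the factor
`G`. -/
theorem dualObjective_le {γ ζ ε β : ℝ} (hγ : 0 < γ) (hζ : 0 < ζ) (hε : 0 < ε)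
    (C : Matrix (Fin F) (Fin G) ℝ) (u : Fin F → ℂ) {R M : ℝ}
    (hM : ∀ x y : ℝ, |x| ≤ R → |y| ≤ R →
      Real.exp y ≤ Real.exp x + Real.exp x * (y - x) + M * (y - x) ^ 2)
    {l l' : Fin F → ℝ} {P : Matrix (Fin F) (Fin G) ℝ}
    (hX : ∀ f g, |dualExponent ε C l P f g| ≤ R) (hX' : ∀ f g, |dualExponent ε C l' P f g| ≤ R)
    (hφ : ∀ f, 1 / 2 * (max (‖u f‖ - γ * β - γ * ζ * l' f) 0) ^ 2
      = 1 / 2 * (max (‖u f‖ - γ * β - γ * ζ * l f) 0) ^ 2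
        - γ * ζ * max (‖u f‖ - γ * β - γ * ζ * l f) 0 * (l' f - l f)
        + (γ * ζ) ^ 2 / 2 * (l' f - l f) ^ 2) :
    dualObjective γ ζ ε β C u l' P ≤
      dualObjective γ ζ ε β C u l P + ∑ f, gradLam γ ζ ε β C u l P f * (l' f - l f)
      + (γ * ζ * M / ε * G + (γ * ζ) ^ 2 / 2) * ∑ f, (l' f - l f) ^ 2 := by
  rw [dualObjective_eq_sum, dualObjective_eq_sum, Finset.mul_sum,
    ← Finset.sum_add_distrib, ← Finset.sum_add_distrib]
  refine Finset.sum_le_sum fun f _ => ?_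
  have hg : ∀ g, γ * ζ * ε * Real.exp (dualExponent ε C l' P f g) ≤
      γ * ζ * ε * Real.exp (dualExponent ε C l P f g)
      + γ * ζ * Real.exp (dualExponent ε C l P f g) * (l' f - l f)
      + γ * ζ * M / ε * (l' f - l f) ^ 2 := by
    intro g
    have h1 := mul_le_mul_of_nonneg_left (hM _ _ (hX f g) (hX' f g))
      (by positivity : 0 ≤ γ * ζ * ε)
    have h2 : dualExponent ε C l' P f g - dualExponent ε C l P f g = (l' f - l f) / ε := by
      unfold dualExponent; ring
    rw [h2] at h1
    refine h1.trans (le_of_eq ?_)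
    field_simp
  have hs := Finset.sum_le_sum fun g (_ : g ∈ Finset.univ) => hg g
  simp only [Finset.sum_add_distrib, ← Finset.mul_sum, ← Finset.sum_mul, Finset.sum_const,
    Finset.card_univ, Fintype.card_fin, nsmul_eq_mul] at hs
  have := hφ f
  simp only [gradLam]
  linarith

/-- First-order optimality of the minimizer of the `Psi`-block. -/
theorem IsPsiArgmin.variational (hG : 0 < G) {ε η : ℝ} (hε : 0 < ε)
    {C : Matrix (Fin F) (Fin G) ℝ} {l : Fin F → ℝ} {P P' : Matrix (Fin F) (Fin G) ℝ}
    (hP : IsPsiArgmin ε η C l P) (hP' : normOneInf P' ≤ η) :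
    0 ≤ ∑ f, ∑ g, Real.exp (dualExponent ε C l P f g) * (P' f g - P f g) := by
  -- `R` bounds the exponents along the whole segment from `P` to `P'`; the first-order condition
  -- comes from letting the segment parameter tend to 0.
  obtain ⟨R, hR⟩ := Finite.exists_le fun i : Fin F × Fin G =>
    |dualExponent ε C l P i.1 i.2| + |(P' i.1 i.2 - P i.1 i.2) / ε|
  obtain ⟨_, M, -, -, hM⟩ := exists_exp_quadratic_bounds R
  refine nonneg_of_mul_nonneg_right (a := ε⁻¹) ?_ (by positivity)
  refine nonneg_of_forall_quadratic_nonneg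
    (c := M * ∑ f, ∑ g, ((P' f g - P f g) / ε) ^ 2) fun t ht ht1 => ?_
  have h0 := hP.2 _ (normOneInf_segment_le hG ht.le ht1 hP.1 hP')
  rw [psiObjective_eq, psiObjective_eq] at h0
  have h1 : ∀ f g, Real.exp (dualExponent ε C l (P + t • (P' - P)) f g) ≤
      Real.exp (dualExponent ε C l P f g)
      + t * (ε⁻¹ * (Real.exp (dualExponent ε C l P f g) * (P' f g - P f g)))
      + t ^ 2 * (M * ((P' f g - P f g) / ε) ^ 2) := by
    intro f g
    have h2 : dualExponent ε C l (P + t • (P' - P)) f g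
        = dualExponent ε C l P f g + t * ((P' f g - P f g) / ε) := by
      simp only [dualExponent, Matrix.add_apply, Matrix.smul_apply, Matrix.sub_apply, smul_eq_mul]
      ring
    have h3 := hR (f, g)
    have h4 : |dualExponent ε C l P f g| ≤ R := by
      linarith [abs_nonneg ((P' f g - P f g) / ε)]
    have h5 : |dualExponent ε C l P f g + t * ((P' f g - P f g) / ε)| ≤ R := by
      refine (abs_add_le _ _).trans (le_trans ?_ h3)
      rw [abs_mul, abs_of_pos ht]
      have := abs_nonneg ((P' f g - P f g) / ε)
      simp only
      nlinarith
    have h6 := (hM _ _ h4 h5).2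
    rw [h2]
    refine h6.trans (le_of_eq ?_)
    ring
  have h2 := Finset.sum_le_sum fun f (_ : f ∈ Finset.univ) =>
    Finset.sum_le_sum fun g (_ : g ∈ Finset.univ) => h1 f g
  simp only [Finset.sum_add_distrib, ← Finset.mul_sum] at h2
  linarith

/-! ### Gap contraction and quadratic growth -/

/-- On the box `lo ≤ lam ≤ up` the term `(|u| - γβ - γζ lam)₊² / 2` is exactly quadratic. -/
def IsQuadraticBox (γ ζ β : ℝ) (u : Fin F → ℂ) (lo up : Fin F → ℝ) : Prop :=
  ∀ f x y, lo f ≤ x → x ≤ up f → lo f ≤ y → y ≤ up f →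
    1 / 2 * (max (‖u f‖ - γ * β - γ * ζ * y) 0) ^ 2
      = 1 / 2 * (max (‖u f‖ - γ * β - γ * ζ * x) 0) ^ 2
        - γ * ζ * max (‖u f‖ - γ * β - γ * ζ * x) 0 * (y - x) + (γ * ζ) ^ 2 / 2 * (y - x) ^ 2

theorem exists_dualExponent_bound (hG : 0 < G) {ε η : ℝ} (hε : 0 < ε)
    (C : Matrix (Fin F) (Fin G) ℝ) (lo up : Fin F → ℝ) :
    ∃ R : ℝ, ∀ l ∈ Set.Icc lo up, ∀ P : Matrix (Fin F) (Fin G) ℝ, normOneInf P ≤ η →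
      ∀ f g, |dualExponent ε C l P f g| ≤ R := by
  obtain ⟨R, hR⟩ := Finite.exists_le fun i : Fin F × Fin G =>
    (|lo i.1| + |up i.1| + η + |C i.1 i.2|) / ε
  refine ⟨R, fun l hl P hP f g => le_trans ?_ (hR (f, g))⟩
  unfold dualExponent
  rw [abs_div, abs_of_pos hε]
  refine div_le_div_of_nonneg_right ?_ hε.le
  have h1 := abs_le_of_normOneInf_le hG hP f g
  have h2 := hl.1 f
  have h3 := hl.2 f
  have h4 : |l f| ≤ |lo f| + |up f| := by
    rw [abs_le]
    constructor <;> linarith [neg_abs_le (lo f), neg_abs_le (up f), le_abs_self (lo f),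
      le_abs_self (up f), abs_nonneg (lo f), abs_nonneg (up f)]
  have h5 := abs_sub (l f + P f g) (C f g)
  have h6 := abs_add_le (l f) (P f g)
  simp only
  linarith

/-- One `lam`-update contracts the optimality gap. -/
theorem exists_gap_contraction (hG : 0 < G) {γ ζ ε β η : ℝ} (hγ : 0 < γ) (hζ : 0 < ζ)
    (hε : 0 < ε) (C : Matrix (Fin F) (Fin G) ℝ) (u : Fin F → ℂ) {lo up : Fin F → ℝ}
    (hbox : IsQuadraticBox γ ζ β u lo up) :
    ∃ r : ℝ, 0 < r ∧ r < 1 ∧ ∀ l ∈ Set.Icc lo up, ∀ lS ∈ Set.Icc lo up,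
      ∀ P PS : Matrix (Fin F) (Fin G) ℝ, IsPsiArgmin ε η C l P → normOneInf PS ≤ η →
      ∀ l' : Fin F → ℝ, (∀ l'' ∈ Set.Icc lo up,
        dualObjective γ ζ ε β C u l' P ≤ dualObjective γ ζ ε β C u l'' P) →
      dualObjective γ ζ ε β C u l' P - dualObjective γ ζ ε β C u lS PS
        ≤ r * (dualObjective γ ζ ε β C u l P - dualObjective γ ζ ε β C u lS PS) := by
  obtain ⟨R, hR⟩ := exists_dualExponent_bound (η := η) hG hε C lo up
  obtain ⟨m, M, hm, hM, hexp⟩ := exists_exp_quadratic_bounds R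
  have hG' : (0 : ℝ) < G := by exact_mod_cast hG
  obtain ⟨μ, hμ⟩ : ∃ μ, μ = (γ * ζ) ^ 2 / 2 := ⟨_, rfl⟩
  obtain ⟨L, hL⟩ : ∃ L, L = γ * ζ * M / ε * G + (γ * ζ) ^ 2 / 2 := ⟨_, rfl⟩
  have hμ0 : 0 < μ := by rw [hμ]; positivity
  have hμL : μ < L := by
    have : 0 < γ * ζ * M / ε * G := by positivity
    linarith
  have hL0 : 0 < L := hμ0.trans hμL
  have ht0 : 0 < μ / L := by positivity
  have ht1 : μ / L < 1 := (div_lt_one hL0).mpr hμL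
  refine ⟨1 - μ / L, by linarith, by linarith, fun l hl lS hlS P PS hP hPS l' hl' => ?_⟩
  -- This step length makes the smoothness loss `L t²` equal to the strong convexity gain `t μ`.
  obtain ⟨t, ht⟩ : ∃ t, t = μ / L := ⟨_, rfl⟩
  rw [← ht] at ht0 ht1 ⊢
  have htL : t * L = μ := by rw [ht]; field_simp
  have hlt : l + t • (lS - l) ∈ Set.Icc lo up :=
    (convex_Icc lo up).add_smul_sub_mem hl hlS ⟨ht0.le, ht1.le⟩
  have h1 := hl' _ hlt
  have h2 := dualObjective_le hγ hζ hε C u (fun x y hx hy => (hexp x y hx hy).2)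
    (hR l hl P hP.1) (hR _ hlt P hP.1)
    (fun f => hbox f _ _ (hl.1 f) (hl.2 f) (hlt.1 f) (hlt.2 f))
  have h3 := dualObjective_ge hγ hζ hε C u (fun x y hx hy => (hexp x y hx hy).1)
    (hR l hl P hP.1) (hR lS hlS PS hPS)
    (fun f => hbox f _ _ (hl.1 f) (hl.2 f) (hlS.1 f) (hlS.2 f))
  -- Optimality of `P` for `l` lets the `Psi` part of the linear term be dropped.
  have h4 := mul_nonneg (mul_pos hγ hζ).le (hP.variational hG hε hPS)
  have h5 : 0 ≤ γ * ζ * m / ε * ∑ f, ∑ g, ((lS f - l f) + (PS f g - P f g)) ^ 2 :=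
    mul_nonneg (by positivity)
      (Finset.sum_nonneg fun f _ => Finset.sum_nonneg fun g _ => sq_nonneg _)
  simp only [Pi.add_apply, Pi.smul_apply, Pi.sub_apply, smul_eq_mul, add_sub_cancel_left,
    mul_pow t] at h2
  simp only [Finset.mul_sum, ← mul_assoc] at h4
  have h6 : ∑ f, gradLam γ ζ ε β C u l P f * (t * (lS f - l f))
      = t * ∑ f, gradLam γ ζ ε β C u l P f * (lS f - l f) := by
    rw [Finset.mul_sum]; exact Finset.sum_congr rfl fun f _ => by ring
  rw [h6, ← Finset.mul_sum] at h2
  rw [← hL] at h2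
  rw [← hμ] at h3
  have h7 : L * (t ^ 2 * ∑ f, (lS f - l f) ^ 2) = t * (μ * ∑ f, (lS f - l f) ^ 2) := by
    rw [← htL]; ring
  have h8 := mul_le_mul_of_nonneg_left (show ∑ f, gradLam γ ζ ε β C u l P f * (lS f - l f)
    + μ * ∑ f, (lS f - l f) ^ 2 ≤ dualObjective γ ζ ε β C u lS PS
      - dualObjective γ ζ ε β C u l P by linarith) ht0.le
  linarith

/-- Quadratic growth of the dual objective away from a minimizer. -/
theorem exists_quadratic_growth (hG : 0 < G) {γ ζ ε β η : ℝ} (hγ : 0 < γ) (hζ : 0 < ζ)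
    (hε : 0 < ε) (C : Matrix (Fin F) (Fin G) ℝ) (u : Fin F → ℂ) {lo up : Fin F → ℝ}
    (hbox : IsQuadraticBox γ ζ β u lo up) {lS : Fin F → ℝ} {PS : Matrix (Fin F) (Fin G) ℝ}
    (hlS : lS ∈ Set.Icc lo up) (hPS : normOneInf PS ≤ η)
    (hmin : ∀ l ∈ Set.Icc lo up, ∀ P : Matrix (Fin F) (Fin G) ℝ, normOneInf P ≤ η →
      dualObjective γ ζ ε β C u lS PS ≤ dualObjective γ ζ ε β C u l P) :
    ∃ κ : ℝ, 0 < κ ∧ ∀ l ∈ Set.Icc lo up, ∀ P : Matrix (Fin F) (Fin G) ℝ, normOneInf P ≤ η →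
      κ * (∑ f, (l f - lS f) ^ 2 + ∑ f, ∑ g, (P f g - PS f g) ^ 2) ≤
        dualObjective γ ζ ε β C u l P - dualObjective γ ζ ε β C u lS PS := by
  obtain ⟨R, hR⟩ := exists_dualExponent_bound (η := η) hG hε C lo up
  obtain ⟨m, M, hm, hM, hexp⟩ := exists_exp_quadratic_bounds R
  obtain ⟨a, ha⟩ : ∃ a, a = γ * ζ * m / ε := ⟨_, rfl⟩
  obtain ⟨μ, hμ⟩ : ∃ μ, μ = (γ * ζ) ^ 2 / 2 := ⟨_, rfl⟩
  have ha0 : 0 < a := by rw [ha]; positivity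
  have hμ0 : 0 < μ := by rw [hμ]; positivity
  have hG' : (0 : ℝ) < G := by exact_mod_cast hG
  -- The two conditions on `κ` absorb the cost of separating the `Psi` square from the coupled
  -- square in `h5`.
  obtain ⟨κ, hκ0, hκa, hκμ⟩ : ∃ κ : ℝ, 0 < κ ∧ 2 * κ ≤ a / 2 ∧ κ * (1 + 2 * G) ≤ μ / 2 := by
    refine ⟨min (a / 4) (μ / 2 / (1 + 2 * G)), by positivity, ?_, ?_⟩
    · linarith [min_le_left (a / 4) (μ / 2 / (1 + 2 * G))]
    · rw [← le_div_iff₀ (by positivity)]; exact min_le_right _ _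
  refine ⟨κ, hκ0, fun l hl P hP => ?_⟩
  -- Expanding about the midpoint towards both ends cancels the linear terms, so no optimality
  -- condition at the minimizer is needed, only that the midpoint value is no smaller.
  have hlt : lS + (1 / 2 : ℝ) • (l - lS) ∈ Set.Icc lo up :=
    (convex_Icc lo up).add_smul_sub_mem hlS hl ⟨by norm_num, by norm_num⟩
  have hPt := normOneInf_segment_le hG (t := 1 / 2) (by norm_num) (by norm_num) hPS hP
  have h1 := hmin _ hlt _ hPt
  have h2 := dualObjective_ge hγ hζ hε C u (fun x y hx hy => (hexp x y hx hy).1)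
    (hR _ hlt _ hPt) (hR l hl P hP)
    (fun f => hbox f _ _ (hlt.1 f) (hlt.2 f) (hl.1 f) (hl.2 f))
  have h3 := dualObjective_ge hγ hζ hε C u (fun x y hx hy => (hexp x y hx hy).1)
    (hR _ hlt _ hPt) (hR lS hlS PS hPS)
    (fun f => hbox f _ _ (hlt.1 f) (hlt.2 f) (hlS.1 f) (hlS.2 f))
  rw [← ha, ← hμ] at h2 h3
  have e1 : ∀ f, l f - (lS + (1 / 2 : ℝ) • (l - lS)) f = 1 / 2 * (l f - lS f) := by
    intro f; simp only [Pi.add_apply, Pi.smul_apply, Pi.sub_apply, smul_eq_mul]; ring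
  have e2 : ∀ f, lS f - (lS + (1 / 2 : ℝ) • (l - lS)) f = -(1 / 2 * (l f - lS f)) := by
    intro f; simp only [Pi.add_apply, Pi.smul_apply, Pi.sub_apply, smul_eq_mul]; ring
  have e3 : ∀ f g, P f g - (PS + (1 / 2 : ℝ) • (P - PS)) f g = 1 / 2 * (P f g - PS f g) := by
    intro f g
    simp only [Matrix.add_apply, Matrix.smul_apply, Matrix.sub_apply, smul_eq_mul]; ring
  have e4 : ∀ f g, PS f g - (PS + (1 / 2 : ℝ) • (P - PS)) f g = -(1 / 2 * (P f g - PS f g)) := by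
    intro f g
    simp only [Matrix.add_apply, Matrix.smul_apply, Matrix.sub_apply, smul_eq_mul]; ring
  simp only [e1, e3] at h2
  simp only [e2, e4, mul_neg, Finset.sum_neg_distrib, ← neg_add, neg_sq] at h3
  simp only [← mul_add, mul_pow, ← Finset.mul_sum] at h2 h3
  have h4 : a / 2 * ∑ f, ∑ g, ((l f - lS f) + (P f g - PS f g)) ^ 2
      + μ / 2 * ∑ f, (l f - lS f) ^ 2
      ≤ dualObjective γ ζ ε β C u l P - dualObjective γ ζ ε β C u lS PS := by
    linarith
  have h5 : ∑ f, ∑ g, (P f g - PS f g) ^ 2 ≤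
      2 * ∑ f, ∑ g, ((l f - lS f) + (P f g - PS f g)) ^ 2 + 2 * G * ∑ f, (l f - lS f) ^ 2 := by
    have h : ∀ f g, (P f g - PS f g) ^ 2 ≤
        2 * ((l f - lS f) + (P f g - PS f g)) ^ 2 + 2 * (l f - lS f) ^ 2 := fun f g => by
      nlinarith [sq_nonneg (2 * (l f - lS f) + (P f g - PS f g))]
    have hs := Finset.sum_le_sum fun f (_ : f ∈ Finset.univ) =>
      Finset.sum_le_sum fun g (_ : g ∈ Finset.univ) => h f g
    simp only [Finset.sum_add_distrib, ← Finset.mul_sum, Finset.sum_const, Finset.card_univ,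
      Fintype.card_fin, nsmul_eq_mul] at hs
    linarith
  have h6 : 0 ≤ ∑ f, (l f - lS f) ^ 2 := Finset.sum_nonneg fun f _ => sq_nonneg _
  have h7 : 0 ≤ ∑ f, ∑ g, ((l f - lS f) + (P f g - PS f g)) ^ 2 :=
    Finset.sum_nonneg fun f _ => Finset.sum_nonneg fun g _ => sq_nonneg _
  have h8 := mul_le_mul_of_nonneg_left h5 hκ0.le
  have h9 := mul_le_mul_of_nonneg_right hκa h7
  have h10 := mul_le_mul_of_nonneg_right hκμ h6
  linarith

/-- Squared errors decay like `r ^ k`, so the rate is `√r`. The gap does not control `e 0` and `e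
1`; each gets its own summand in `A`. -/
theorem exists_sqrt_le_geometric {e gap : ℕ → ℝ} {κ r : ℝ} (hκ : 0 < κ) (hr0 : 0 < r) (hr1 : r < 1)
    (he : ∀ k, κ * e (k + 2) ≤ gap k) (hgap : ∀ k, gap (k + 1) ≤ r * gap k) :
    ∃ A q : ℝ, 0 < q ∧ q < 1 ∧ ∀ k : ℕ, Real.sqrt (e k) ≤ A * q ^ k := by
  have hgeo : ∀ k, gap k ≤ r ^ k * gap 0 := by
    intro k
    induction k with
    | zero => simp
    | succ k ih =>
      calc gap (k + 1) ≤ r * gap k := hgap k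
        _ ≤ r * (r ^ k * gap 0) := by gcongr
        _ = r ^ (k + 1) * gap 0 := by ring
  have hq0 : 0 < Real.sqrt r := Real.sqrt_pos.mpr hr0
  have hq1 : Real.sqrt r < 1 := (Real.sqrt_lt' one_pos).mpr (by simpa using hr1)
  obtain ⟨q, hq⟩ : ∃ q, q = Real.sqrt r := ⟨_, rfl⟩
  have hqr : q ^ 2 = r := by rw [hq]; exact Real.sq_sqrt hr0.le
  rw [← hq] at hq0 hq1
  have s0 := Real.sqrt_nonneg (e 0)
  have s1 := Real.sqrt_nonneg (e 1)
  have s2 := Real.sqrt_nonneg (gap 0 / κ)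
  refine ⟨Real.sqrt (e 0) + Real.sqrt (e 1) / q + Real.sqrt (gap 0 / κ) / q ^ 2, q, hq0, hq1, ?_⟩
  have p1 : 0 ≤ Real.sqrt (e 1) / q := by positivity
  have p2 : 0 ≤ Real.sqrt (gap 0 / κ) / q ^ 2 := by positivity
  intro k
  match k with
  | 0 => rw [pow_zero]; linarith
  | 1 =>
    have : Real.sqrt (e 1) = Real.sqrt (e 1) / q * q := by field_simp
    rw [pow_one]; nlinarith
  | k + 2 =>
    have h1 : e (k + 2) ≤ (q ^ k) ^ 2 * (gap 0 / κ) := by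
      rw [← pow_mul, mul_comm k 2, pow_mul, hqr, ← mul_div_assoc, le_div_iff₀ hκ]
      linarith [he k, hgeo k]
    have h2 : Real.sqrt (e (k + 2)) ≤ q ^ k * Real.sqrt (gap 0 / κ) := by
      refine (Real.sqrt_le_sqrt h1).trans (le_of_eq ?_)
      rw [Real.sqrt_mul (by positivity), Real.sqrt_sq (by positivity)]
    have h3 : q ^ k * Real.sqrt (gap 0 / κ) = Real.sqrt (gap 0 / κ) / q ^ 2 * q ^ (k + 2) := by
      rw [pow_add]; field_simp
    refine h2.trans (h3.le.trans ?_)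
    gcongr
    linarith

/-! ### Linear convergence of alternating minimization -/

/-- Alternating minimization over `Λ` and the ball converges linearly when the exact `lam`-step
stays in a box on which the `lam`-term is quadratic. -/
theorem exists_isDualMinimizer_convergesLinearly (hG : 0 < G) {γ ζ ε β η : ℝ} (hγ : 0 < γ)
    (hζ : 0 < ζ) (hε : 0 < ε) (hη : 0 ≤ η) {C : Matrix (Fin F) (Fin G) ℝ} {u : Fin F → ℂ}
    {lo up : Fin F → ℝ} (hbox : IsQuadraticBox γ ζ β u lo up) {Λ : Set (Fin F → ℝ)}
    (hΛ : Set.Icc lo up ⊆ Λ) {step : Matrix (Fin F) (Fin G) ℝ → Fin F → ℝ}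
    (hmem : ∀ P, normOneInf P ≤ η → step P ∈ Set.Icc lo up)
    (hstep : ∀ P, ∀ l ∈ Λ,
      dualObjective γ ζ ε β C u (step P) P ≤ dualObjective γ ζ ε β C u l P)
    {lam : ℕ → Fin F → ℝ} {Psi : ℕ → Matrix (Fin F) (Fin G) ℝ}
    (hit : IsIteration step ε η C lam Psi) :
    ∃ (lamS : Fin F → ℝ) (PsiS : Matrix (Fin F) (Fin G) ℝ),
      IsDualMinimizer Λ γ ζ ε β η C u lamS PsiS ∧ ConvergesLinearly lam Psi lamS PsiS := by
  obtain ⟨lS, PS, hlS, hPS, hmin⟩ : ∃ (lS : Fin F → ℝ) (PS : Matrix (Fin F) (Fin G) ℝ),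
      lS ∈ Set.Icc lo up ∧ normOneInf PS ≤ η ∧ ∀ l ∈ Set.Icc lo up,
      ∀ P : Matrix (Fin F) (Fin G) ℝ, normOneInf P ≤ η →
        dualObjective γ ζ ε β C u lS PS ≤ dualObjective γ ζ ε β C u l P := by
    obtain ⟨⟨lS, PS⟩, hz, hmin⟩ := ((isCompact_Icc (a := lo) (b := up)).prod
      (isCompact_normOneInf_le (F := F) hG η)).exists_isMinOn
      ⟨(step 0, 0), hmem 0 (normOneInf_zero_le hG hη), normOneInf_zero_le hG hη⟩
      (continuous_dualObjective γ ζ ε β C u).continuousOn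
    exact ⟨lS, PS, hz.1, hz.2, fun l hl P hP => hmin (a := (l, P)) ⟨hl, hP⟩⟩
  -- A minimizer over the box is one over `Λ`: replacing `l` by `step P` lands in the box without
  -- raising the objective.
  refine ⟨lS, PS, ⟨hΛ hlS, hPS, fun l P hl hP =>
    (hmin _ (hmem P hP) P hP).trans (hstep P l hl)⟩, ?_⟩
  obtain ⟨r, hr0, hr1, hr⟩ := exists_gap_contraction (η := η) hG hγ hζ hε C u hbox
  obtain ⟨κ, hκ, hgrow⟩ := exists_quadratic_growth hG hγ hζ hε C u hbox hlS hPS hmin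
  -- The shift by 2 is needed because `Psi 0` may lie outside the ball, so `lam 1` may leave the
  -- box.
  have hlam : ∀ k, lam (k + 2) ∈ Set.Icc lo up := fun k => by
    rw [(hit (k + 1)).1]; exact hmem _ (hit k).2.1
  refine exists_sqrt_le_geometric (gap := fun k => dualObjective γ ζ ε β C u (lam (k + 2))
    (Psi (k + 2)) - dualObjective γ ζ ε β C u lS PS) hκ hr0 hr1
    (fun k => hgrow _ (hlam k) _ (hit (k + 1)).2.1) fun k => ?_
  have h1 := hr _ (hlam k) lS hlS _ PS (hit (k + 1)).2 hPS (lam (k + 3)) fun l hl => by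
    rw [(hit (k + 2)).1]; exact hstep _ l (hΛ hl)
  refine le_trans ?_ h1
  -- The following `Psi`-step leaves the `lam` term alone and cannot raise the exponential term.
  have h2 := (hit (k + 2)).2.2 _ (hit (k + 1)).2.1
  rw [dualObjective_eq_psiObjective γ ζ ε β C u (lam (k + 3)) (Psi (k + 2)),
    dualObjective_eq_psiObjective γ ζ ε β C u (lam (k + 1 + 2)) (Psi (k + 1 + 2))]
  have h3 := mul_le_mul_of_nonneg_left h2 (by positivity : 0 ≤ γ * ζ * ε)
  simp only [Nat.add_assoc, Nat.reduceAdd] at h3 ⊢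
  linarith

/-! ### The closed-form `lam`-update -/

theorem wrightOmega_lt_exp (x : ℝ) : wrightOmega x < Real.exp x := by
  have h := wrightOmega_pos x
  rw [← wrightOmega_mul_exp x]
  exact lt_mul_of_one_lt_right h (Real.one_lt_exp_iff.mpr h)

/-- The row sums `(K ⊙ W) 1_G`. -/
noncomputable def kernelRowSum (ε : ℝ) (C Psi : Matrix (Fin F) (Fin G) ℝ) (f : Fin F) : ℝ :=
  ∑ g, kernelK ε C f g * kernelW ε Psi f g

theorem kernelRowSum_pos (hG : 0 < G) (ε : ℝ) (C Psi : Matrix (Fin F) (Fin G) ℝ) (f : Fin F) :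
    0 < kernelRowSum ε C Psi f :=
  Finset.sum_pos (fun _ _ => mul_pos (Real.exp_pos _) (Real.exp_pos _)) ⟨⟨0, hG⟩, Finset.mem_univ _⟩

/-- Uniform over the ball, since `C ≥ 0` gives `K ≤ 1`; this bounds the unprojected update from
below. -/
theorem kernelRowSum_le (hG : 0 < G) {ε η : ℝ} (hε : 0 < ε) {C Psi : Matrix (Fin F) (Fin G) ℝ}
    (hC : ∀ f g, 0 ≤ C f g) (hP : normOneInf Psi ≤ η) (f : Fin F) :
    kernelRowSum ε C Psi f ≤ G * Real.exp (η / ε) := by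
  have h : ∀ g ∈ Finset.univ, kernelK ε C f g * kernelW ε Psi f g ≤ Real.exp (η / ε) := by
    intro g _
    unfold kernelK kernelW
    rw [← Real.exp_add, Real.exp_le_exp, ← add_div]
    refine div_le_div_of_nonneg_right ?_ hε.le
    linarith [hC f g, le_abs_self (Psi f g), abs_le_of_normOneInf_le hG hP f g]
  have := Finset.sum_le_card_nsmul _ _ _ h
  simpa [kernelRowSum] using this

theorem dualObjective_eq_kernelRowSum (γ ζ ε β : ℝ) (C : Matrix (Fin F) (Fin G) ℝ)
    (u : Fin F → ℂ) (lam : Fin F → ℝ) (Psi : Matrix (Fin F) (Fin G) ℝ) :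
    dualObjective γ ζ ε β C u lam Psi =
      ∑ f, (γ * ζ * ε * (kernelRowSum ε C Psi f * Real.exp (lam f / ε))
        + 1 / 2 * (max (‖u f‖ - γ * β - γ * ζ * lam f) 0) ^ 2) := by
  unfold dualObjective kernelRowSum scalingV
  simp only [Finset.sum_add_distrib, Finset.mul_sum, Finset.sum_mul]

theorem exp_xi (hG : 0 < G) {γ ζ ε β : ℝ} (hγ : 0 < γ) (hζ : 0 < ζ) (hε : 0 < ε)
    (C : Matrix (Fin F) (Fin G) ℝ) (u : Fin F → ℂ) (Psi : Matrix (Fin F) (Fin G) ℝ) (f : Fin F) :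
    Real.exp (xi γ ζ ε β C u Psi f) = kernelRowSum ε C Psi f *
      Real.exp ((‖u f‖ - γ * β) / (γ * ζ * ε)) / (γ * ζ * ε) := by
  have h := kernelRowSum_pos hG ε C Psi f
  unfold xi
  rw [Real.exp_sub, Real.exp_add, Real.exp_log (by positivity : 0 < γ * ζ * ε)]
  congr 2
  exact Real.exp_log h

theorem lamFormula_eq {γ ζ : ℝ} (hγ : 0 < γ) (hζ : 0 < ζ) (ε β : ℝ)
    (C : Matrix (Fin F) (Fin G) ℝ) (u : Fin F → ℂ) (Psi : Matrix (Fin F) (Fin G) ℝ) (f : Fin F) :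
    lamFormula γ ζ ε β C u Psi f =
      (‖u f‖ - γ * β) / (γ * ζ) - ε * wrightOmega (xi γ ζ ε β C u Psi f) := by
  unfold lamFormula
  field_simp

theorem lamFormula_lt {γ ζ ε : ℝ} (hγ : 0 < γ) (hζ : 0 < ζ) (hε : 0 < ε) (β : ℝ)
    (C : Matrix (Fin F) (Fin G) ℝ) (u : Fin F → ℂ) (Psi : Matrix (Fin F) (Fin G) ℝ) (f : Fin F) :
    lamFormula γ ζ ε β C u Psi f < (‖u f‖ - γ * β) / (γ * ζ) := by
  rw [lamFormula_eq hγ hζ]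
  have := mul_pos hε (wrightOmega_pos (xi γ ζ ε β C u Psi f))
  linarith

/-- The closed form is a stationary point of the `lam`-block. -/
theorem kernelRowSum_mul_exp_lamFormula (hG : 0 < G) {γ ζ ε β : ℝ} (hγ : 0 < γ) (hζ : 0 < ζ)
    (hε : 0 < ε) (C : Matrix (Fin F) (Fin G) ℝ) (u : Fin F → ℂ) (Psi : Matrix (Fin F) (Fin G) ℝ)
    (f : Fin F) :
    kernelRowSum ε C Psi f * Real.exp (lamFormula γ ζ ε β C u Psi f / ε)
      = ‖u f‖ - γ * β - γ * ζ * lamFormula γ ζ ε β C u Psi f := by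
  have h1 := wrightOmega_mul_exp (xi γ ζ ε β C u Psi f)
  rw [exp_xi hG hγ hζ hε, eq_div_iff (by positivity)] at h1
  rw [lamFormula_eq hγ hζ]
  -- The right side is `γζε w`, so the claim is `w eʷ = exp ξ` in disguise.
  obtain ⟨w, hw⟩ : ∃ w, w = wrightOmega (xi γ ζ ε β C u Psi f) := ⟨_, rfl⟩
  rw [← hw] at h1 ⊢
  have h2 : ((‖u f‖ - γ * β) / (γ * ζ) - ε * w) / ε = (‖u f‖ - γ * β) / (γ * ζ * ε) - w := by
    field_simp
  rw [h2, Real.exp_sub, ← mul_div_assoc, ← h1]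
  field_simp
  ring

/-- First-order sufficient condition for the `lam`-block. -/
theorem dualObjective_le_of_variational {γ ζ ε β : ℝ} (hγ : 0 < γ) (hζ : 0 < ζ) (hε : 0 < ε)
    (hG : 0 < G) (C : Matrix (Fin F) (Fin G) ℝ) (u : Fin F → ℂ) {l l' : Fin F → ℝ}
    (Psi : Matrix (Fin F) (Fin G) ℝ)
    (h : ∀ f, 0 ≤ (kernelRowSum ε C Psi f * Real.exp (l f / ε)
      - max (‖u f‖ - γ * β - γ * ζ * l f) 0) * (l' f - l f)) :
    dualObjective γ ζ ε β C u l Psi ≤ dualObjective γ ζ ε β C u l' Psi := by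
  rw [dualObjective_eq_kernelRowSum, dualObjective_eq_kernelRowSum]
  refine Finset.sum_le_sum fun f _ => ?_
  have hs := kernelRowSum_pos hG ε C Psi f
  have h1 := half_sq_posPart_tangent (‖u f‖ - γ * β - γ * ζ * l f) (‖u f‖ - γ * β - γ * ζ * l' f)
  have h2 : Real.exp (l f / ε) * ((l' f - l f) / ε + 1) ≤ Real.exp (l' f / ε) := by
    have h3 : l' f / ε = l f / ε + (l' f - l f) / ε := by ring
    rw [h3, Real.exp_add]
    exact mul_le_mul_of_nonneg_left (Real.add_one_le_exp _) (Real.exp_pos _).le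
  have h4 := mul_le_mul_of_nonneg_left h2 (by positivity : 0 ≤ γ * ζ * ε * kernelRowSum ε C Psi f)
  have h5 : γ * ζ * ε * kernelRowSum ε C Psi f *
      (Real.exp (l f / ε) * ((l' f - l f) / ε + 1)) =
      γ * ζ * ε * (kernelRowSum ε C Psi f * Real.exp (l f / ε))
      + γ * ζ * (kernelRowSum ε C Psi f * Real.exp (l f / ε) * (l' f - l f)) := by
    field_simp
    ring
  have h6 := mul_nonneg (mul_pos hγ hζ).le (h f)
  rw [h5] at h4
  linarith

theorem dualObjective_lamFormula_le (hG : 0 < G) {γ ζ ε β : ℝ} (hγ : 0 < γ) (hζ : 0 < ζ)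
    (hε : 0 < ε) (C : Matrix (Fin F) (Fin G) ℝ) (u : Fin F → ℂ) (Psi : Matrix (Fin F) (Fin G) ℝ)
    (l : Fin F → ℝ) :
    dualObjective γ ζ ε β C u (lamFormula γ ζ ε β C u Psi) Psi
      ≤ dualObjective γ ζ ε β C u l Psi := by
  refine dualObjective_le_of_variational hγ hζ hε hG C u Psi fun f => ?_
  have h := kernelRowSum_mul_exp_lamFormula (β := β) hG hγ hζ hε C u Psi f
  have h1 : 0 < kernelRowSum ε C Psi f * Real.exp (lamFormula γ ζ ε β C u Psi f / ε) :=
    mul_pos (kernelRowSum_pos hG ε C Psi f) (Real.exp_pos _)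
  rw [← h, max_eq_left h1.le, sub_self, zero_mul]

/-- For fixed `Psi` the objective is a sum of convex functions of single coordinates, so clipping
the free minimizer at 0 gives the constrained one. -/
theorem dualObjective_posPart_lamFormula_le (hG : 0 < G) {γ ζ ε β : ℝ} (hγ : 0 < γ) (hζ : 0 < ζ)
    (hε : 0 < ε) (C : Matrix (Fin F) (Fin G) ℝ) (u : Fin F → ℂ) (Psi : Matrix (Fin F) (Fin G) ℝ)
    {l : Fin F → ℝ} (hl : ∀ f, 0 ≤ l f) :
    dualObjective γ ζ ε β C u (fun f => max (lamFormula γ ζ ε β C u Psi f) 0) Psi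
      ≤ dualObjective γ ζ ε β C u l Psi := by
  refine dualObjective_le_of_variational hγ hζ hε hG C u Psi fun f => ?_
  have h := kernelRowSum_mul_exp_lamFormula (β := β) hG hγ hζ hε C u Psi f
  have hs := kernelRowSum_pos hG ε C Psi f
  have h1 : 0 < kernelRowSum ε C Psi f * Real.exp (lamFormula γ ζ ε β C u Psi f / ε) :=
    mul_pos hs (Real.exp_pos _)
  rcases le_total 0 (lamFormula γ ζ ε β C u Psi f) with h0 | h0
  · rw [max_eq_left h0, ← h, max_eq_left h1.le, sub_self, zero_mul]
  · rw [max_eq_right h0]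
    -- Moving from the stationary point up to 0 raises the exponential and lowers the linear term,
    -- so the derivative at 0 is nonnegative.
    refine mul_nonneg (sub_nonneg.mpr (max_le ?_ ?_)) (by linarith [hl f])
    · have h2 : Real.exp (lamFormula γ ζ ε β C u Psi f / ε) ≤ Real.exp (0 / ε) := by gcongr
      have h3 := mul_le_mul_of_nonneg_left h2 hs.le
      have h4 : γ * ζ * lamFormula γ ζ ε β C u Psi f ≤ 0 :=
        mul_nonpos_of_nonneg_of_nonpos (mul_pos hγ hζ).le h0
      linarith
    · positivity

/-- Below the threshold the positive part acts as the identity; in the other case the interval has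
at most one point. -/
theorem isQuadraticBox_of_le_div {γ ζ β : ℝ} (hγ : 0 < γ) (hζ : 0 < ζ) (u : Fin F → ℂ)
    {lo up : Fin F → ℝ} (h : ∀ f, up f ≤ (‖u f‖ - γ * β) / (γ * ζ) ∨ up f ≤ lo f) :
    IsQuadraticBox γ ζ β u lo up := by
  intro f x y hx hx' hy hy'
  rcases h f with h | h
  · have key : ∀ z, z ≤ up f → 0 ≤ ‖u f‖ - γ * β - γ * ζ * z := by
      intro z hz
      have := (le_div_iff₀ (mul_pos hγ hζ)).mp (hz.trans h)
      linarith
    rw [max_eq_left (key x hx'), max_eq_left (key y hy')]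
    ring
  · have : y = x := by linarith
    rw [this]
    ring

end DetDual

/-! ### The two schemes -/

open DetDual

theorem proposition5 (F G : ℕ) (hG : 0 < G) (γ ζ ε β η : ℝ)
    (hγ : 0 < γ) (hζ : 0 < ζ) (hε : 0 < ε) (hβ : 0 ≤ β) (hη : 0 ≤ η)
    (C : Matrix (Fin F) (Fin G) ℝ) (hC : ∀ f g, 0 ≤ C f g) (u : Fin F → ℂ) :
    -- the minimization defining the `Psi`-update always has exactly one solution
    (∀ lam : Fin F → ℝ, ∃! Psi : Matrix (Fin F) (Fin G) ℝ, DetDual.IsPsiArgmin ε η C lam Psi) ∧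
    -- positive part of the closed form as `lam`-update: solution of the dual problem
    (∀ (lam : ℕ → Fin F → ℝ) (Psi : ℕ → Matrix (Fin F) (Fin G) ℝ),
      DetDual.IsIteration (fun P f => max (DetDual.lamFormula γ ζ ε β C u P f) 0) ε η C lam Psi →
      ∃ (lamS : Fin F → ℝ) (PsiS : Matrix (Fin F) (Fin G) ℝ),
        DetDual.IsDualSolution γ ζ ε β η C u lamS PsiS ∧
        DetDual.ConvergesLinearly lam Psi lamS PsiS) ∧
    -- the closed form itself as `lam`-update: minimizer over all real `lam`, which solves the
    -- dual problem as soon as it is nonnegative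
    (∀ (lam : ℕ → Fin F → ℝ) (Psi : ℕ → Matrix (Fin F) (Fin G) ℝ),
      DetDual.IsIteration (DetDual.lamFormula γ ζ ε β C u) ε η C lam Psi →
      ∃ (lamS : Fin F → ℝ) (PsiS : Matrix (Fin F) (Fin G) ℝ),
        DetDual.IsDualMinimizer Set.univ γ ζ ε β η C u lamS PsiS ∧
        ((∀ f, 0 ≤ lamS f) → DetDual.IsDualSolution γ ζ ε β η C u lamS PsiS) ∧
        DetDual.ConvergesLinearly lam Psi lamS PsiS) := by
  refine ⟨existsUnique_isPsiArgmin hG hε hη C, fun lam Psi hit => ?_, fun lam Psi hit => ?_⟩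
  · refine exists_isDualMinimizer_convergesLinearly (lo := fun _ => 0)
      (up := fun f => max ((‖u f‖ - γ * β) / (γ * ζ)) 0) hG hγ hζ hε hη
      (isQuadraticBox_of_le_div hγ hζ u fun f => ?_) (fun l hl f => hl.1 f)
      (fun P _ => ⟨fun f => le_max_right _ _, fun f =>
        max_le_max_right 0 (lamFormula_lt hγ hζ hε β C u P f).le⟩)
      (fun P l hl => dualObjective_posPart_lamFormula_le hG hγ hζ hε C u P hl) hit
    -- A nonpositive threshold collapses this side of the box to `{0}`.
    rcases le_total 0 ((‖u f‖ - γ * β) / (γ * ζ)) with h | h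
    · exact Or.inl (max_eq_left h).le
    · exact Or.inr (max_eq_right h).le
  -- The lower end of the box comes from `ω(x) < exp x` and the row-sum bound.
  · have hlo : ∀ P, normOneInf P ≤ η → ∀ f, (‖u f‖ - γ * β) / (γ * ζ) - ε *
        (G * Real.exp (η / ε) * Real.exp ((‖u f‖ - γ * β) / (γ * ζ * ε)) / (γ * ζ * ε))
        ≤ lamFormula γ ζ ε β C u P f := by
      intro P hP f
      rw [lamFormula_eq hγ hζ]
      have h1 := (wrightOmega_lt_exp (xi γ ζ ε β C u P f)).le
      rw [exp_xi hG hγ hζ hε] at h1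
      have h2 := kernelRowSum_le hG hε hC hP f
      refine sub_le_sub_left (mul_le_mul_of_nonneg_left (h1.trans ?_) hε.le) _
      gcongr
    obtain ⟨lS, PS, hmin, hconv⟩ := exists_isDualMinimizer_convergesLinearly
      (up := fun f => (‖u f‖ - γ * β) / (γ * ζ)) hG hγ hζ hε hη
      (isQuadraticBox_of_le_div hγ hζ u fun f => Or.inl le_rfl) (Set.subset_univ _)
      (fun P hP => ⟨hlo P hP, fun f => (lamFormula_lt hγ hζ hε β C u P f).le⟩)
      (fun P l _ => dualObjective_lamFormula_le hG hγ hζ hε C u P l) hit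
    exact ⟨lS, PS, hmin, fun h0 => ⟨h0, hmin.2.1, fun l P _ hP =>
      hmin.2.2 l P (Set.mem_univ l) hP⟩, hconv⟩
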